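/- Let $\mathcal X\subset\mathbb R^{D_x}$ and $\mathcal Y\subset\mathbb R^{D_y}$ be non-empty compact sets, $\mathcal Y$ of positive Lebesgue measure, let $c:\mathcal X\times\mathcal Y\to\mathbb R$ be continuous, $\varepsilon>0$, and let $\mathbb P,\mathbb Q$ be Borel probability measures on $\mathcal X,\mathcal Y$. Write $H(\mu)=-\int\log\frac{d\mu(y)}{dy}\,d\mu(y)$ for the differential entropy ($H(\mu)=-\infty$ if $\mu$ is not absolutely continuous with respect to Lebesgue measure). Let $\pi^*$ be a solution of the entropic optimal transport problem $$F^*=\mathrm{EOT}_{c,\varepsilon}(\mathbb P,\mathbb Q)=\min_{\pi\in\Pi(\mathbb P,\mathbb Q)}\int c\,d\pi-\varepsilon\int_{\mathcal X}H(\pi(\cdot|x))\,d\mathbb P(x)\in(-\infty,+\infty],$$ where $\Pi(\mathbb P,\mathbb Q)$ is the set of couplings of $\mathbb P$ and $\mathbb Q$. For $f\in C(\mathcal Y)$ put $$f^{C_{\rm EOT}}(x)=\inf_{\mu\in\mathcal P(\mathcal Y)}\Big\{\int c(x,y)\,d\mu(y)-\varepsilon H(\mu)-\int f\,d\mu\Big\},\qquad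 F^w(f)=\int f^{C_{\rm EOT}}\,d\mathbb P+\int f\,d\mathbb Q,$$ $$Z(f,x)=\int_{\mathcal Y}e^{(f(y)-c(x,y))/\varepsilon}\,dy,\qquad d\pi^f(x,y)=\frac{e^{(f(y)-c(x,y))/\varepsilon}}{Z(f,x)}\,dy\,d\mathbb P(x).$$ Let $\mathcal F\subset C(\mathcal Y)$ with $\sup_{f\in\mathcal F}F^w(f)<\infty$, and let $\mathcal F^{C_{\rm EOT}}=\{-\varepsilon\log Z(f,\cdot):f\in\mathcal F\}$. Let $N,M\ge 1$, let $x_1,\dots,x_N$ be independent samples from $\mathbb P$ and $y_1,\dots,y_M$ independent samples from $\mathbb Q$, and let $\widehat f$ (depending on the samples) be a maximizer over $\mathcal F$ of the empirical weak dual objective $$\widehat F(f)=-\frac{\varepsilon}{N}\sum_{n=1}^N\log Z(f,x_n)+\frac1M\sum_{m=1}^Mf(y_m).$$ For a class $\mathcal H$ of functions and a probability measure $\mu$, let $\mathcal R_N(\mathcal H,\mu)=\frac1N\,\mathbb E\sup_{h\in\mathcal H}\sum_{n=1}^N\sigma_nh(z_n)\in[0,\infty]$ be the Rademacher complexity, with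 $z_n\sim\mu$ i.i.d. and $\sigma_n$ independent uniform random signs that are independent of the $z_n$. Then $$\mathbb E\big[D_{\rm KL}(\pi^*\|\pi^{\widehat f})\big]\le\varepsilon^{-1}\big[4\mathcal R_N(\mathcal F^{C_{\rm EOT}},\mathbb P)+4\mathcal R_M(\mathcal F,\mathbb Q)\big]+\varepsilon^{-1}\Big[F^*-\sup_{f\in\mathcal F}F^w(f)\Big],$$ the supremum being $\max_{f\in\mathcal F}F^w(f)$ whenever the maximum is attained. The inequality is understood in $(-\infty,+\infty]$. -/

import Mathlib

open MeasureTheory ProbabilityTheory TopologicalSpace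
open scoped ENNReal

/-- The extended integral `∫ g⁺ dμ - ∫ g⁻ dμ` of an extended-real-valued function. -/
noncomputable def extIntegral {Z : Type*} [MeasurableSpace Z] (g : Z → EReal) (μ : Measure Z) :
    EReal :=
  ((∫⁻ z, (g z).toENNReal ∂μ : ℝ≥0∞) : EReal) - ((∫⁻ z, (-g z).toENNReal ∂μ : ℝ≥0∞) : EReal)

/-- The Rademacher complexity `(1 / N) E sup_{h ∈ H} ∑ n, σ n * h (x n)`, where the `x n` are
i.i.d. with law `μ` and the `σ n` are independent uniform signs; the expectation over the
signs is the average over the `2 ^ N` sign vectors. Its value is `⊤` if the expectation is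
infinite. -/
noncomputable def rademacherComplexity {Z : Type*} [MeasurableSpace Z] (N : ℕ)
    (H : Set (Z → ℝ)) (μ : Measure Z) : EReal :=
  ((((N : ℝ) * 2 ^ N)⁻¹ : ℝ) : EReal) *
    ∑ σ : Fin N → ℤˣ,
      extIntegral (fun x : Fin N → Z => ⨆ h ∈ H, ((∑ n, ((σ n : ℤ) : ℝ) * h (x n) : ℝ) : EReal))
        (Measure.pi fun _ => μ)

namespace EOT

instance instStandardBorelSpace {E : Type*} [MetricSpace E] [CompleteSpace E]
    [SecondCountableTopology E] [MeasurableSpace E] [BorelSpace E] (K : NonemptyCompacts E) :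
    StandardBorelSpace K :=
  MeasurableSet.standardBorel K.isCompact.isClosed.measurableSet

/-- Lebesgue measure on a compact subset of Euclidean space. -/
noncomputable instance instMeasureSpace (d : ℕ) (K : NonemptyCompacts (EuclideanSpace ℝ (Fin d))) :
    MeasureSpace K :=
  Measure.Subtype.measureSpace

theorem volume_univ (d : ℕ) (K : NonemptyCompacts (EuclideanSpace ℝ (Fin d))) :
    (volume : Measure K) Set.univ = volume (K : Set (EuclideanSpace ℝ (Fin d))) :=
  Measure.Subtype.volume_univ (u := (K : Set (EuclideanSpace ℝ (Fin d))))
    K.isCompact.isClosed.measurableSet.nullMeasurableSet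

instance instIsFiniteMeasureVolume (d : ℕ) (K : NonemptyCompacts (EuclideanSpace ℝ (Fin d))) :
    IsFiniteMeasure (volume : Measure K) where
  measure_univ_lt_top := by
    rw [volume_univ]
    exact K.isCompact.measure_lt_top

/-- The differential entropy `H(μ) = -∫ log (dμ/dy) dμ`, equal to `-∞` if `μ` is not absolutely
continuous with respect to the reference (Lebesgue) measure. -/
noncomputable def entropy {Y : Type*} [MeasureSpace Y] (μ : Measure Y) : EReal :=
  open Classical in
  if μ ≪ volume then
    -extIntegral (fun y => ENNReal.log (μ.rnDeriv volume y)) μ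
  else ⊥

section

variable {X Y : Type*} [MeasurableSpace X] [TopologicalSpace Y] [MeasureSpace Y]

/-- The weak transport cost `∫ c(x, y) dμ(y) - ε H(μ)`. -/
noncomputable def weakCost (c : X → Y → ℝ) (ε : ℝ) (x : X) (μ : Measure Y) : EReal :=
  ((∫ y, c x y ∂μ : ℝ) : EReal) - (ε : EReal) * entropy μ

/-- The weak transform `f^C(x)`: the infimum over all probability measures `μ` on `Y` of
`C(x, μ) - ∫ f dμ`. -/
noncomputable def weakTransform (c : X → Y → ℝ) (ε : ℝ) (f : C(Y, ℝ)) (x : X) : EReal :=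
  ⨅ μ : ProbabilityMeasure Y,
    weakCost c ε x (μ : Measure Y) - ((∫ y, f y ∂(μ : Measure Y) : ℝ) : EReal)

/-- The weak dual functional `F^w(f) = ∫ f^C dP + ∫ f dQ`. -/
noncomputable def weakDual (c : X → Y → ℝ) (ε : ℝ) (P : Measure X) (Q : Measure Y)
    (f : C(Y, ℝ)) : ℝ :=
  ∫ x, (weakTransform c ε f x).toReal ∂P + ∫ y, f y ∂Q

/-- The partition function `Z(f, x) = ∫ exp ((f(y) - c(x, y)) / ε) dy`. -/
noncomputable def partition (c : X → Y → ℝ) (ε : ℝ) (f : C(Y, ℝ)) (x : X) : ℝ :=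
  ∫ y, Real.exp ((f y - c x y) / ε)

/-- The class `{-ε log Z(f, ·) : f ∈ F}` of weak transforms of the functions in `F`. -/
noncomputable def transformClass (c : X → Y → ℝ) (ε : ℝ) (F : Set C(Y, ℝ)) : Set (X → ℝ) :=
  (fun f x => -ε * Real.log (partition c ε f x)) '' F

/-- The empirical weak dual objective
`-ε (1/N) ∑ n, log Z(f, x n) + (1/M) ∑ m, f (y m)`. -/
noncomputable def empiricalDual (c : X → Y → ℝ) (ε : ℝ) {N M : ℕ} (x : Fin N → X)
    (y : Fin M → Y) (f : C(Y, ℝ)) : ℝ :=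
  -ε * ((1 / N) * ∑ n, Real.log (partition c ε f (x n))) + (1 / M) * ∑ m, f (y m)

/-- The Gibbs kernel `x ↦ μ_x^f`, where `μ_x^f` has Lebesgue density
`exp ((f(y) - c(x, y)) / ε) / Z(f, x)`. -/
noncomputable def gibbs [SFinite (volume : Measure Y)] (c : X → Y → ℝ) (ε : ℝ) (f : C(Y, ℝ)) :
    Kernel X Y :=
  Kernel.withDensity (Kernel.const X volume) fun x y =>
    ENNReal.ofReal (Real.exp ((f y - c x y) / ε) / partition c ε f x)

/-- The plan `dπ^f(x, y) = dμ_x^f(y) dP(x)`. -/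
noncomputable def plan [SFinite (volume : Measure Y)] (c : X → Y → ℝ) (ε : ℝ) (P : Measure X)
    (f : C(Y, ℝ)) : Measure (X × Y) :=
  P ⊗ₘ gibbs c ε f

/-- The kernel `gibbs` is not degenerate: for a continuous cost, it has the stated density. -/
theorem gibbs_apply [TopologicalSpace X] [SecondCountableTopology X] [OpensMeasurableSpace X]
    [SecondCountableTopology Y] [OpensMeasurableSpace Y]
    [SFinite (volume : Measure Y)] (c : X → Y → ℝ) (hc : Continuous fun p : X × Y => c p.1 p.2)
    (ε : ℝ) (f : C(Y, ℝ)) (x : X) :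
    gibbs c ε f x = volume.withDensity fun y =>
      ENNReal.ofReal (Real.exp ((f y - c x y) / ε) / partition c ε f x) := by
  have h1 : Measurable fun p : X × Y => Real.exp ((f p.2 - c p.1 p.2) / ε) := by
    have : Continuous fun p : X × Y => Real.exp ((f p.2 - c p.1 p.2) / ε) := by fun_prop
    exact this.measurable
  have h2 : Measurable fun x => partition c ε f x :=
    (h1.stronglyMeasurable.integral_prod_right).measurable
  have h3 : Measurable (Function.uncurry fun x y =>
      ENNReal.ofReal (Real.exp ((f y - c x y) / ε) / partition c ε f x)) :=
    ENNReal.measurable_ofReal.comp (h1.div (h2.comp measurable_fst))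
  rw [gibbs, Kernel.withDensity_apply _ h3, Kernel.const_apply]

/-- The set `Π(P, Q)` of couplings of `P` and `Q`. -/
def couplings (P : Measure X) (Q : Measure Y) : Set (ProbabilityMeasure (X × Y)) :=
  {π | (π : Measure (X × Y)).fst = P ∧ (π : Measure (X × Y)).snd = Q}

variable [StandardBorelSpace Y] [Nonempty Y]

/-- The primal objective `∫ c dπ - ε ∫ H(π(· | x)) dP(x)`, with `P` the first marginal
of `π`. -/
noncomputable def primalObjective (c : X → Y → ℝ) (ε : ℝ) (P : Measure X)
    (π : ProbabilityMeasure (X × Y)) : EReal :=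
  ((∫ p, c p.1 p.2 ∂(π : Measure (X × Y)) : ℝ) : EReal) -
    (ε : EReal) * extIntegral (fun x => entropy ((π : Measure (X × Y)).condKernel x)) P

/-- The optimal value of the entropic optimal transport problem. -/
noncomputable def optimalValue (c : X → Y → ℝ) (ε : ℝ) (P : Measure X) (Q : Measure Y) : EReal :=
  ⨅ π ∈ couplings P Q, primalObjective c ε P π

/-- `π` solves the entropic optimal transport problem. -/
def IsOptimalPlan (c : X → Y → ℝ) (ε : ℝ) (P : Measure X) (Q : Measure Y)
    (π : ProbabilityMeasure (X × Y)) : Prop :=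
  π ∈ couplings P Q ∧ ∀ π' ∈ couplings P Q, primalObjective c ε P π ≤ primalObjective c ε P π'

end

end EOT

/-! The Gibbs variational formula on each fibre says that `-H(μ)` is the divergence of `μ` from the
Gibbs measure of `f` plus an explicit affine term. Integrated over the disintegration of a coupling
`π`, it gives an exact identity for every `f`: the primal objective of `π` is `ε * KL(π ‖ π^f) +
F^w(f)` (`EOT.primalObjective_eq`). At the optimal plan, the divergence to bound is therefore `ε⁻¹
(F* - F^w(f̂))`, which splits into the approximation gap `ε⁻¹ (F* - sup F^w)` and the estimation
error `ε⁻¹ (sup F^w - F^w(f̂))`.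

Since `f̂` maximizes the empirical objective, the estimation error is at most the sum, over the two
samples, of an oscillation: a supremum over pairs `h, h'` of the deviation of the empirical mean of
`h - h'` (`EOT.ofReal_sSup_sub_weakDual_le`). Symmetrization with a ghost sample bounds each
expected oscillation by four Rademacher complexities (`lintegral_deviationOsc_le`): one factor 2
comes from the pair of functions, the other from the two samples.

Suprema and divergences may be infinite, so most of the argument runs in `ℝ≥0∞`; extended integrals
are reduced to a nonnegative part plus an integrable real part. -/

open InformationTheory

/-! ### Extended integrals of functions with an integrable lower bound -/

/-- If `g = b + s` with `b` nonnegative and `s` integrable, then the negative part of `g` has a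
finite integral, and the integral of the positive part is determined by `b` and `s`. -/
theorem lintegral_toENNReal_coe_add {Z : Type*} [MeasurableSpace Z] {μ : Measure Z}
    {b : Z → ℝ≥0∞} (hb : AEMeasurable b μ) {s : Z → ℝ} (hs : Integrable s μ) :
    ∃ n : ℝ, ((∫⁻ z, (-((b z : EReal) + (s z : EReal))).toENNReal ∂μ : ℝ≥0∞) : EReal) = n ∧
      ((∫⁻ z, ((b z : EReal) + (s z : EReal)).toENNReal ∂μ : ℝ≥0∞) : EReal) =
        ((∫⁻ z, b z ∂μ : ℝ≥0∞) : EReal) + ((∫ z, s z ∂μ : ℝ) : EReal) + n := by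
  have hg : AEMeasurable (fun z => (b z : EReal) + (s z : EReal)) μ :=
    (hb.coe_ereal_ennreal).add hs.aemeasurable.coe_real_ereal
  have hfin : ∫⁻ z, (-((b z : EReal) + (s z : EReal))).toENNReal ∂μ ≠ ∞ := by
    refine ((lintegral_mono fun z => ?_).trans_lt hs.neg.lintegral_lt_top).ne
    rcases eq_or_ne (b z) ∞ with h | h
    · simp [h]
    · lift b z to NNReal using h with r
      rw [show ((r : ℝ≥0∞) : EReal) = ((r : ℝ) : EReal) from rfl, ← EReal.coe_add,
        ← EReal.coe_neg, EReal.toENNReal_of_ne_top (EReal.coe_ne_top _)]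
      simp only [EReal.toReal_coe, Pi.neg_apply]
      exact ENNReal.ofReal_le_ofReal (by have := r.2; linarith [NNReal.coe_nonneg r])
  -- The identity `g = b + s⁺ - s⁻`, rearranged so that no subtraction occurs and `b = ∞` is
  -- allowed.
  have hpt : ∀ z, ((b z : EReal) + (s z : EReal)).toENNReal + ENNReal.ofReal (-s z) =
      (-((b z : EReal) + (s z : EReal))).toENNReal + (b z + ENNReal.ofReal (s z)) := by
    intro z
    rcases eq_or_ne (b z) ∞ with h | h
    · simp [h]
    · lift b z to NNReal using h with r
      rw [show ((r : ℝ≥0∞) : EReal) = ((r : ℝ) : EReal) from rfl, ← EReal.coe_add,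
        ← EReal.coe_neg, EReal.toENNReal_of_ne_top (EReal.coe_ne_top _), EReal.toENNReal_of_ne_top (EReal.coe_ne_top _)]
      simp only [EReal.toReal_coe]
      rw [← ENNReal.ofReal_coe_nnreal]
      have hr := NNReal.coe_nonneg r
      generalize (r : ℝ) = r at *
      rcases le_total 0 (s z) with h1 | h1
      · rw [ENNReal.ofReal_of_nonpos (by linarith : -s z ≤ 0),
          ENNReal.ofReal_of_nonpos (by linarith : -(r + s z) ≤ 0), ENNReal.ofReal_add hr h1]
        simp
      · rw [ENNReal.ofReal_of_nonpos h1]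
        rcases le_total 0 (r + s z) with h2 | h2
        · rw [ENNReal.ofReal_of_nonpos (by linarith : -(r + s z) ≤ 0),
            ← ENNReal.ofReal_add h2 (by linarith)]
          simp
        · rw [ENNReal.ofReal_of_nonpos h2, add_zero, ← ENNReal.ofReal_add (by linarith) hr]
          simp
  have hint := lintegral_congr (μ := μ) hpt
  rw [lintegral_add_right' (fun z => ((b z : EReal) + (s z : EReal)).toENNReal)
      (g := fun z => ENNReal.ofReal (-s z)) hs.aemeasurable.neg.ennreal_ofReal,
    lintegral_add_left' (f := fun z => (-((b z : EReal) + (s z : EReal))).toENNReal)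
      hg.neg.ereal_toENNReal, lintegral_add_left' hb] at hint
  refine ⟨(∫⁻ z, (-((b z : EReal) + (s z : EReal))).toENNReal ∂μ).toReal, ?_, ?_⟩
  · rw [EReal.coe_ennreal_toReal hfin]
  have h1 : ∫⁻ z, ENNReal.ofReal (-s z) ∂μ ≠ ∞ := hs.neg.lintegral_lt_top.ne
  have h2 : ∫⁻ z, ENNReal.ofReal (s z) ∂μ ≠ ∞ := hs.lintegral_lt_top.ne
  rw [integral_eq_lintegral_pos_part_sub_lintegral_neg_part hs]
  generalize (∫⁻ z, (-((b z : EReal) + (s z : EReal))).toENNReal ∂μ) = N at *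
  generalize (∫⁻ z, ((b z : EReal) + (s z : EReal)).toENNReal ∂μ) = A at *
  generalize ∫⁻ z, ENNReal.ofReal (-s z) ∂μ = S' at *
  generalize ∫⁻ z, ENNReal.ofReal (s z) ∂μ = S at *
  generalize ∫⁻ z, b z ∂μ = B at *
  lift N to NNReal using hfin
  lift S to NNReal using h2
  lift S' to NNReal using h1
  induction B with
  | top =>
    have : A = ∞ := by
      by_contra hA
      lift A to NNReal using hA
      simp at hint
    rw [this, EReal.coe_ennreal_top, EReal.top_add_coe, EReal.top_add_coe]
  | coe B =>
    have hA : A ≠ ∞ := by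
      rintro rfl
      simp at hint
      exact absurd hint.symm (by exact_mod_cast ENNReal.coe_ne_top)
    lift A to NNReal using hA
    have : A + S' = N + (B + S) := by exact_mod_cast hint
    have : (A : ℝ) + S' = N + (B + S) := by exact_mod_cast this
    change ((A : ℝ) : EReal) = ((B : ℝ) : EReal) + _ + _
    simp only [ENNReal.coe_toReal]
    norm_cast
    linarith

theorem extIntegral_coe_add {Z : Type*} [MeasurableSpace Z] {μ : Measure Z}
    {b : Z → ℝ≥0∞} (hb : AEMeasurable b μ) {s : Z → ℝ} (hs : Integrable s μ) :
    extIntegral (fun z => (b z : EReal) + (s z : EReal)) μ =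
      ((∫⁻ z, b z ∂μ : ℝ≥0∞) : EReal) + ((∫ z, s z ∂μ : ℝ) : EReal) := by
  obtain ⟨n, h1, h2⟩ := lintegral_toENNReal_coe_add hb hs
  rw [extIntegral, h1, h2, EReal.add_sub_cancel_right]

/-- Negation exchanges the two integrals; since the one of the negative part of `b + s` is finite,
no `∞ - ∞` arises. -/
theorem extIntegral_neg_coe_add {Z : Type*} [MeasurableSpace Z] {μ : Measure Z}
    {b : Z → ℝ≥0∞} (hb : AEMeasurable b μ) {s : Z → ℝ} (hs : Integrable s μ) :
    extIntegral (fun z => -((b z : EReal) + (s z : EReal))) μ =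
      -(((∫⁻ z, b z ∂μ : ℝ≥0∞) : EReal) + ((∫ z, s z ∂μ : ℝ) : EReal)) := by
  rw [← extIntegral_coe_add hb hs]
  obtain ⟨n, h1, h2⟩ := lintegral_toENNReal_coe_add hb hs
  simp only [extIntegral, neg_neg]
  rw [h1, EReal.neg_sub (by simp) (by simp), add_comm, ← sub_eq_add_neg]

theorem extIntegral_congr_ae {Z : Type*} [MeasurableSpace Z] {μ : Measure Z} {g g' : Z → EReal}
    (h : g =ᵐ[μ] g') : extIntegral g μ = extIntegral g' μ := by
  rw [extIntegral, extIntegral, lintegral_congr_ae (h.mono fun z hz => congrArg EReal.toENNReal hz),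
    lintegral_congr_ae (h.mono fun z hz => congrArg (fun t => (-t).toENNReal) hz)]

/-! ### Divergence between kernels -/

section KernelDivergence

variable {α β : Type*} {mα : MeasurableSpace α} {mβ : MeasurableSpace β}
  [MeasurableSpace.CountableOrCountablyGenerated α β]

theorem klDiv_kernel_eq (κ η : Kernel α β) [IsFiniteKernel κ] [IsFiniteKernel η] {a : α}
    (h : κ a ≪ η a) :
    klDiv (κ a) (η a) = ∫⁻ y, ENNReal.ofReal (klFun (κ.rnDeriv η a y).toReal) ∂(η a) := by
  rw [klDiv_eq_lintegral_klFun_of_ac h]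
  refine lintegral_congr_ae ?_
  filter_upwards [Kernel.rnDeriv_eq_rnDeriv_measure (κ := κ) (η := η) (a := a)] with y hy
  rw [hy]

theorem measurable_ofReal_klFun_rnDeriv (κ η : Kernel α β) :
    Measurable fun p : α × β => ENNReal.ofReal (klFun (κ.rnDeriv η p.1 p.2).toReal) :=
  (measurable_klFun.comp (κ.measurable_rnDeriv η).ennreal_toReal).ennreal_ofReal

/-- The kernel density is jointly measurable, and the set where absolute continuity fails is
measurable. -/
theorem measurable_klDiv_kernel (κ η : Kernel α β) [IsFiniteKernel κ] [IsFiniteKernel η] :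
    Measurable fun a => klDiv (κ a) (η a) := by
  classical
  have : (fun a => klDiv (κ a) (η a)) = fun a => if κ a ≪ η a then
      ∫⁻ y, ENNReal.ofReal (klFun (κ.rnDeriv η a y).toReal) ∂(η a) else ∞ := by
    funext a
    split_ifs with h
    · exact klDiv_kernel_eq κ η h
    · exact klDiv_of_not_ac h
  rw [this]
  exact Measurable.ite (Kernel.measurableSet_absolutelyContinuous κ η)
    (measurable_ofReal_klFun_rnDeriv κ η).lintegral_kernel_prod_right measurable_const

/-- The integral form of the conditional Kullback-Leibler divergence. -/
theorem klDiv_compProd_right (μ : Measure α) [IsFiniteMeasure μ] (κ η : Kernel α β)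
    [IsFiniteKernel κ] [IsFiniteKernel η] :
    klDiv (μ ⊗ₘ κ) (μ ⊗ₘ η) = ∫⁻ a, klDiv (κ a) (η a) ∂μ := by
  -- If absolute continuity holds on almost every fibre, the kernel density is the density of the
  -- joint measures; otherwise both sides are infinite.
  by_cases h : ∀ᵐ a ∂μ, κ a ≪ η a
  · have hd : μ ⊗ₘ κ = (μ ⊗ₘ η).withDensity fun p => κ.rnDeriv η p.1 p.2 := by
      rw [← Measure.compProd_withDensity (κ.measurable_rnDeriv η)]
      exact Measure.compProd_congr (h.mono fun a ha => (Kernel.withDensity_rnDeriv_eq ha).symm)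
    have hac : μ ⊗ₘ κ ≪ μ ⊗ₘ η := Measure.AbsolutelyContinuous.compProd_right h
    rw [klDiv_eq_lintegral_klFun_of_ac hac,
      ← lintegral_congr_ae (h.mono fun a ha => (klDiv_kernel_eq κ η ha).symm),
      ← Measure.lintegral_compProd (measurable_ofReal_klFun_rnDeriv κ η)]
    refine lintegral_congr_ae ?_
    have := Measure.rnDeriv_withDensity (μ ⊗ₘ η) (κ.measurable_rnDeriv η)
    rw [← hd] at this
    filter_upwards [this] with p hp
    rw [hp]
  · rw [klDiv_of_not_ac fun hac => h hac.kernel_of_compProd]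
    refine (eq_top_iff.2 ?_).symm
    have hm := Kernel.measurableSet_absolutelyContinuous κ η
    calc ∞ = ∫⁻ a in {a | κ a ≪ η a}ᶜ, ∞ ∂μ := by
          rw [setLIntegral_const, ENNReal.top_mul]
          exact h
      _ = ∫⁻ a in {a | κ a ≪ η a}ᶜ, klDiv (κ a) (η a) ∂μ :=
          setLIntegral_congr_fun hm.compl fun a ha => (klDiv_of_not_ac ha).symm
      _ ≤ _ := setLIntegral_le_lintegral _ _

end KernelDivergence

/-! ### Entropy and the Gibbs variational formula -/

/-- With `ρ` the density, `log ρ ≥ 1 - ρ⁻¹` and `∫ ρ⁻¹ dμ ≤ ν(Y) < ∞`. So the negative part of `log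
ρ` is always integrable, and failure of integrability can only mean the value `⊤`. -/
theorem extIntegral_log_rnDeriv {Y : Type*} [MeasurableSpace Y] (μ ν : Measure Y)
    [IsFiniteMeasure μ] [IsFiniteMeasure ν] (h : μ ≪ ν) :
    (Integrable (llr μ ν) μ →
      extIntegral (fun y => ENNReal.log (μ.rnDeriv ν y)) μ = ((∫ y, llr μ ν y ∂μ : ℝ) : EReal)) ∧
    (¬ Integrable (llr μ ν) μ → extIntegral (fun y => ENNReal.log (μ.rnDeriv ν y)) μ = ⊤) := by
  have hpos := Measure.rnDeriv_pos h
  have hlt := h.ae_le (Measure.rnDeriv_lt_top μ ν)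
  have hlog : ∀ᵐ y ∂μ, ENNReal.log (μ.rnDeriv ν y) = (llr μ ν y : EReal) := by
    filter_upwards [hpos, hlt] with y h1 h2
    rw [ENNReal.log_pos_real h1.ne' h2.ne, llr]
  constructor
  · intro hi
    have := extIntegral_coe_add (b := fun _ => 0) aemeasurable_const hi
    rw [← extIntegral_congr_ae (hlog.mono fun y hy => by simpa using hy)] at this
    simpa using this
  · intro hi
    set r : Y → ℝ := fun y => ((μ.rnDeriv ν y)⁻¹).toReal
    have hrm : Measurable r := (Measure.measurable_rnDeriv μ ν).inv.ennreal_toReal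
    have hr : Integrable r μ := by
      refine integrable_toReal_of_lintegral_ne_top
        (Measure.measurable_rnDeriv μ ν).inv.aemeasurable (ne_top_of_le_ne_top
          (measure_ne_top ν Set.univ) ?_)
      rw [← lintegral_rnDeriv_mul h (f := fun y => (μ.rnDeriv ν y)⁻¹)
        (Measure.measurable_rnDeriv μ ν).inv.aemeasurable,
        ← lintegral_one]
      exact lintegral_mono fun y => ENNReal.mul_inv_le_one _
    have hb : AEMeasurable (fun y => ENNReal.ofReal (llr μ ν y + r y)) μ :=
      ((measurable_llr μ ν).add hrm).ennreal_ofReal.aemeasurable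
    have hnn : ∀ᵐ y ∂μ, 0 ≤ llr μ ν y + r y := by
      filter_upwards [hpos, hlt] with y h1 h2
      have h3 : 0 < (μ.rnDeriv ν y).toReal := ENNReal.toReal_pos h1.ne' h2.ne
      have := Real.one_sub_inv_le_log_of_pos h3
      simp only [llr, r, ENNReal.toReal_inv]
      linarith
    have := extIntegral_coe_add hb hr.neg
    rw [← extIntegral_congr_ae (g := fun y => ENNReal.log (μ.rnDeriv ν y))] at this
    · rw [this]
      have htop : ∫⁻ y, ENNReal.ofReal (llr μ ν y + r y) ∂μ = ∞ := by
        by_contra hne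
        refine hi ?_
        have := (lintegral_ofReal_ne_top_iff_integrable
          ((measurable_llr μ ν).add hrm).aestronglyMeasurable hnn).1 hne
        simpa using this.sub hr
      rw [htop]
      exact EReal.top_add_coe _
    · filter_upwards [hlog, hnn] with y h1 h2
      rw [h1, EReal.coe_ennreal_ofReal, max_eq_left h2, ← EReal.coe_add]
      simp

/-- The Gibbs variational formula. -/
theorem EOT.neg_entropy_eq {Y : Type*} [MeasureSpace Y] [IsFiniteMeasure (volume : Measure Y)]
    [NeZero (volume : Measure Y)] (μ : Measure Y) [IsProbabilityMeasure μ] {g : Y → ℝ}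
    (hg : Integrable g μ) (he : Integrable (fun y => Real.exp (g y)) volume) :
    -EOT.entropy μ = (klDiv μ ((volume : Measure Y).tilted g) : EReal) +
      ((∫ y, g y ∂μ - Real.log (∫ y, Real.exp (g y)) : ℝ) : EReal) := by
  have := isProbabilityMeasure_tilted he
  have hiff : μ ≪ (volume : Measure Y).tilted g ↔ μ ≪ volume :=
    ⟨fun h => h.trans (tilted_absolutelyContinuous _ _),
      fun h => h.trans (absolutelyContinuous_tilted he)⟩
  by_cases h : μ ≪ (volume : Measure Y)
  · rw [EOT.entropy, if_pos h, neg_neg]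
    obtain ⟨h1, h2⟩ := extIntegral_log_rnDeriv μ volume h
    by_cases hi : Integrable (llr μ volume) μ
    · rw [h1 hi, klDiv_of_ac_of_integrable (hiff.2 h) (integrable_llr_tilted_right h hg hi he),
        EReal.coe_ennreal_ofReal, max_eq_left, integral_llr_tilted_right h hg he hi]
      · simp only [probReal_univ]
        norm_cast
        ring
      · exact integral_llr_add_sub_measure_univ_nonneg (hiff.2 h)
          (integrable_llr_tilted_right h hg hi he)
    · rw [h2 hi, klDiv_of_not_integrable, EReal.coe_ennreal_top, EReal.top_add_coe]
      -- Tilting changes the log-likelihood ratio by `g` and a constant, both integrable, so the two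
      -- ratios are integrable together.
      intro hi'
      refine hi ?_
      have := (hi'.add hg).sub (integrable_const (Real.log (∫ z, Real.exp (g z))))
      refine this.congr ?_
      filter_upwards [llr_tilted_right h he] with y hy
      simp only [Pi.add_apply, Pi.sub_apply, hy]
      ring
  · rw [EOT.entropy, if_neg h, klDiv_of_not_ac (hiff.not.2 h), EReal.coe_ennreal_top,
      EReal.top_add_coe, EReal.neg_bot]

theorem Continuous.integrable_of_compactSpace {Z : Type*} [TopologicalSpace Z] [CompactSpace Z]
    [MeasurableSpace Z] [OpensMeasurableSpace Z] {h : Z → ℝ} (hh : Continuous h)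
    (μ : Measure Z) [IsFiniteMeasure μ] : Integrable h μ :=
  hh.integrable_of_hasCompactSupport (HasCompactSupport.of_compactSpace h)

/-! ### Gibbs plans and the exact duality gap -/

namespace EOT

section

variable {X Y : Type*} [TopologicalSpace X] [TopologicalSpace Y]
  [MeasureSpace Y] [BorelSpace Y] [IsFiniteMeasure (volume : Measure Y)] {c : X → Y → ℝ} {ε : ℝ}

theorem gibbs_eq_tilted [SecondCountableTopology X] [MeasurableSpace X] [OpensMeasurableSpace X]
    [SecondCountableTopology Y] (hc : Continuous fun p : X × Y => c p.1 p.2)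
    (f : C(Y, ℝ)) (x : X) :
    gibbs c ε f x = (volume : Measure Y).tilted fun y => (f y - c x y) / ε :=
  gibbs_apply c hc ε f x

variable [CompactSpace Y]

theorem integrable_exp (hc : Continuous fun p : X × Y => c p.1 p.2) (f : C(Y, ℝ)) (x : X) :
    Integrable (fun y => Real.exp ((f y - c x y) / ε)) volume := by
  have h : Continuous fun y => c x y := hc.comp (Continuous.prodMk_right x)
  exact Continuous.integrable_of_compactSpace (by fun_prop) _

theorem partition_pos [NeZero (volume : Measure Y)] (hc : Continuous fun p : X × Y => c p.1 p.2)
    (f : C(Y, ℝ)) (x : X) : 0 < partition c ε f x :=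
  integral_exp_pos (integrable_exp hc f x)

section

variable [CompactSpace X] [T2Space X] [SecondCountableTopology X]

theorem continuous_partition (hc : Continuous fun p : X × Y => c p.1 p.2) (f : C(Y, ℝ)) :
    Continuous (partition c ε f) := by
  have h : Continuous fun p : X × Y => Real.exp ((f p.2 - c p.1 p.2) / ε) := by fun_prop
  have := continuous_parametric_integral_of_continuous (μ := (volume : Measure Y))
    (f := fun x y => Real.exp ((f y - c x y) / ε)) h isCompact_univ
  simp only [Measure.restrict_univ] at this
  exact this

theorem continuous_log_partition [NeZero (volume : Measure Y)]
    (hc : Continuous fun p : X × Y => c p.1 p.2) (f : C(Y, ℝ)) :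
    Continuous fun x => Real.log (partition c ε f x) :=
  (continuous_partition hc f).log fun x => (partition_pos hc f x).ne'

theorem continuous_of_mem_transformClass [NeZero (volume : Measure Y)]
    (hc : Continuous fun p : X × Y => c p.1 p.2)
    {F : Set C(Y, ℝ)} : ∀ h ∈ transformClass c ε F, Continuous h := by
  rintro _ ⟨f, -, rfl⟩
  exact (continuous_log_partition hc f).const_mul (-ε)

end

variable [SecondCountableTopology X] [MeasurableSpace X] [BorelSpace X]
  [SecondCountableTopology Y]

theorem isMarkovKernel_gibbs [NeZero (volume : Measure Y)]
    (hc : Continuous fun p : X × Y => c p.1 p.2) (f : C(Y, ℝ)) :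
    IsMarkovKernel (gibbs c ε f) :=
  ⟨fun x => by
    rw [gibbs_eq_tilted hc]
    exact isProbabilityMeasure_tilted (integrable_exp hc f x)⟩

theorem neg_entropy_eq_gibbs [NeZero (volume : Measure Y)]
    (hc : Continuous fun p : X × Y => c p.1 p.2) (f : C(Y, ℝ)) (x : X) (μ : Measure Y)
    [IsProbabilityMeasure μ] :
    -entropy μ = (klDiv μ (gibbs c ε f x) : EReal) +
      ((∫ y, (f y - c x y) / ε ∂μ - Real.log (partition c ε f x) : ℝ) : EReal) := by
  have h : Continuous fun y => c x y := hc.comp (Continuous.prodMk_right x)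
  rw [gibbs_eq_tilted hc]
  exact neg_entropy_eq μ (Continuous.integrable_of_compactSpace (by fun_prop) _)
    (integrable_exp hc f x)

theorem coe_sub_mul_sub_coe {ε : ℝ} (hε : 0 < ε) (a s : ℝ) (k : ℝ≥0∞) (H : EReal)
    (hH : -H = (k : EReal) + (s : EReal)) :
    (a : EReal) - (ε : EReal) * H = (ε : EReal) * k + ((a + ε * s : ℝ) : EReal) := by
  rw [sub_eq_add_neg, ← mul_neg, hH]
  induction k with
  | top =>
    rw [EReal.coe_ennreal_top, EReal.top_add_coe, EReal.coe_mul_top_of_pos hε,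
      EReal.top_add_coe, EReal.coe_add_top]
  | coe k =>
    change _ + _ * (((k : ℝ) : EReal) + _) = _ * ((k : ℝ) : EReal) + _
    norm_cast
    ring

theorem weakCost_sub_eq [NeZero (volume : Measure Y)] (hε : 0 < ε)
    (hc : Continuous fun p : X × Y => c p.1 p.2) (f : C(Y, ℝ)) (x : X) (μ : Measure Y)
    [IsProbabilityMeasure μ] :
    weakCost c ε x μ - ((∫ y, f y ∂μ : ℝ) : EReal) =
      (ε : EReal) * klDiv μ (gibbs c ε f x) +
        ((-ε * Real.log (partition c ε f x) : ℝ) : EReal) := by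
  have h : Continuous fun y => c x y := hc.comp (Continuous.prodMk_right x)
  rw [weakCost, coe_sub_mul_sub_coe hε _ _ _ _ (neg_entropy_eq_gibbs (ε := ε) hc f x μ),
    sub_eq_add_neg, add_assoc, ← EReal.coe_neg, ← EReal.coe_add, integral_div,
    integral_sub (f.continuous.integrable_of_compactSpace _) (h.integrable_of_compactSpace _)]
  congr 2
  field_simp
  ring

/-- The functional being minimized is `ε` times a divergence plus a constant; the divergence is
nonnegative and vanishes at the Gibbs measure. -/
theorem weakTransform_eq [NeZero (volume : Measure Y)] (hε : 0 < ε)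
    (hc : Continuous fun p : X × Y => c p.1 p.2) (f : C(Y, ℝ)) (x : X) :
    weakTransform c ε f x = ((-ε * Real.log (partition c ε f x) : ℝ) : EReal) := by
  have := isMarkovKernel_gibbs (ε := ε) hc f
  refine le_antisymm ?_ (le_iInf fun μ => ?_)
  · refine (iInf_le _ (⟨gibbs c ε f x, inferInstance⟩ : ProbabilityMeasure Y)).trans ?_
    rw [ProbabilityMeasure.coe_mk, weakCost_sub_eq hε hc, klDiv_self]
    simp
  · rw [weakCost_sub_eq hε hc]
    exact le_add_of_nonneg_left (mul_nonneg (by exact_mod_cast hε.le) (EReal.coe_ennreal_nonneg _))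

theorem weakDual_eq [NeZero (volume : Measure Y)] (hε : 0 < ε)
    (hc : Continuous fun p : X × Y => c p.1 p.2) (P : Measure X) (Q : Measure Y) (f : C(Y, ℝ)) :
    weakDual c ε P Q f = ∫ x, -ε * Real.log (partition c ε f x) ∂P + ∫ y, f y ∂Q := by
  simp only [weakDual, weakTransform_eq hε hc, EReal.toReal_coe]

variable [CompactSpace X] [T2Space X]

/-- The duality gap of `f` is `ε` times the divergence from the plan of `f`. -/
theorem primalObjective_eq [NeZero (volume : Measure Y)] [StandardBorelSpace Y] [Nonempty Y]
    (hε : 0 < ε) (hc : Continuous fun p : X × Y => c p.1 p.2) {P : Measure X} {Q : Measure Y}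
    [IsProbabilityMeasure P] {π : ProbabilityMeasure (X × Y)} (hπ : π ∈ couplings P Q)
    (f : C(Y, ℝ)) :
    primalObjective c ε P π = (ε : EReal) * klDiv (π : Measure (X × Y)) (plan c ε P f) +
      (weakDual c ε P Q f : EReal) := by
  have := isMarkovKernel_gibbs (ε := ε) hc f
  set κ := (π : Measure (X × Y)).condKernel
  have hd : P ⊗ₘ κ = (π : Measure (X × Y)) := by
    rw [← hπ.1]
    exact (π : Measure (X × Y)).disintegrate _
  have hkl : klDiv (π : Measure (X × Y)) (plan c ε P f) =
      ∫⁻ x, klDiv (κ x) (gibbs c ε f x) ∂P := by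
    rw [plan, ← klDiv_compProd_right, hd]
  have hfc : Continuous fun p : X × Y => (f p.2 - c p.1 p.2) / ε := by fun_prop
  have hi : Integrable (fun p : X × Y => (f p.2 - c p.1 p.2) / ε) (P ⊗ₘ κ) :=
    hfc.integrable_of_compactSpace _
  have hi' : Integrable (fun x => ∫ y, (f y - c x y) / ε ∂κ x) P := hi.integral_compProd
  have hl := (continuous_log_partition (ε := ε) hc f).integrable_of_compactSpace P
  have hs : Integrable (fun x => ∫ y, (f y - c x y) / ε ∂κ x - Real.log (partition c ε f x)) P :=
    hi'.sub hl
  have hent : -extIntegral (fun x => entropy (κ x)) P =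
      (klDiv (π : Measure (X × Y)) (plan c ε P f) : EReal) +
        ((∫ x, (∫ y, (f y - c x y) / ε ∂κ x - Real.log (partition c ε f x)) ∂P : ℝ) : EReal) := by
    have := extIntegral_neg_coe_add
      (measurable_klDiv_kernel κ (gibbs c ε f)).aemeasurable (μ := P) hs
    simp only [← neg_entropy_eq_gibbs (ε := ε) hc f _ (κ _), neg_neg] at this
    rw [this, neg_neg, hkl]
  rw [primalObjective, coe_sub_mul_sub_coe hε _ _ _ _ hent]
  congr 1
  rw [EReal.coe_eq_coe_iff]
  -- The second marginal of `π` enters only here, turning `∫ f dπ` into `∫ f dQ`.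
  have h1 : ∫ x, (∫ y, (f y - c x y) / ε ∂κ x) ∂P = (∫ y, f y ∂Q -
      ∫ p, c p.1 p.2 ∂(π : Measure (X × Y))) / ε := by
    rw [← Measure.integral_compProd hi, hd, integral_div, integral_sub, ← hπ.2, Measure.snd,
      integral_map measurable_snd.aemeasurable f.continuous.aestronglyMeasurable]
    · exact Continuous.integrable_of_compactSpace (by fun_prop) _
    · exact hc.integrable_of_compactSpace _
  rw [integral_sub hi' hl, h1, weakDual_eq hε hc, integral_const_mul]
  field_simp
  ring

end

end EOT

/-! ### Symmetrization and Rademacher complexity -/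

theorem ofReal_integral_le_lintegral {Z : Type*} [MeasurableSpace Z] {μ : Measure Z} {g : Z → ℝ}
    (hg : Integrable g μ) : ENNReal.ofReal (∫ z, g z ∂μ) ≤ ∫⁻ z, ENNReal.ofReal (g z) ∂μ := by
  rw [integral_eq_lintegral_pos_part_sub_lintegral_neg_part hg]
  exact ENNReal.ofReal_le_of_le_toReal (sub_le_self _ ENNReal.toReal_nonneg)

theorem EReal.coe_ennreal_sum {ι : Type*} (s : Finset ι) (b : ι → ℝ≥0∞) :
    ((∑ i ∈ s, b i : ℝ≥0∞) : EReal) = ∑ i ∈ s, (b i : EReal) :=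
  map_sum ({ toFun := fun t => (t : EReal), map_zero' := rfl, map_add' := EReal.coe_ennreal_add } :
    ℝ≥0∞ →+ EReal) b s

theorem EReal.coe_real_sum {ι : Type*} (s : Finset ι) (b : ι → ℝ) :
    ((∑ i ∈ s, b i : ℝ) : EReal) = ∑ i ∈ s, (b i : EReal) :=
  map_sum ({ toFun := fun t => (t : EReal), map_zero' := rfl, map_add' := EReal.coe_add } :
    ℝ →+ EReal) b s

section Rademacher

variable {Z : Type*} {N : ℕ}

/-- The supremum over `h ∈ H` of the signed sums of `h - h₀`. -/
noncomputable def signedExcess (H : Set (Z → ℝ)) (h₀ : Z → ℝ) (σ : Fin N → ℤˣ) (x : Fin N → Z) :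
    ℝ≥0∞ :=
  ⨆ h ∈ H, ENNReal.ofReal (∑ n, ((σ n : ℤ) : ℝ) * (h (x n) - h₀ (x n)))

/-- Centring at a member `h₀` of the class makes the supremum nonnegative, hence `ℝ≥0∞`-valued, at
the price of one real term. -/
theorem iSup_signedSum_eq {H : Set (Z → ℝ)} {h₀ : Z → ℝ} (h₀H : h₀ ∈ H) (σ : Fin N → ℤˣ)
    (x : Fin N → Z) :
    ⨆ h ∈ H, ((∑ n, ((σ n : ℤ) : ℝ) * h (x n) : ℝ) : EReal) =
      (signedExcess H h₀ σ x : EReal) + ((∑ n, ((σ n : ℤ) : ℝ) * h₀ (x n) : ℝ) : EReal) := by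
  set s : ℝ := ∑ n, ((σ n : ℤ) : ℝ) * h₀ (x n)
  set S : EReal := ⨆ h ∈ H, ((∑ n, ((σ n : ℤ) : ℝ) * h (x n) : ℝ) : EReal)
  have hsum : ∀ h : Z → ℝ, ∑ n, ((σ n : ℤ) : ℝ) * (h (x n) - h₀ (x n)) =
      ∑ n, ((σ n : ℤ) : ℝ) * h (x n) - s := fun h => by
    simp only [mul_sub, Finset.sum_sub_distrib, s]
  have hle : ∀ h ∈ H, ((∑ n, ((σ n : ℤ) : ℝ) * h (x n) : ℝ) : EReal) ≤ S := fun h hh =>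
    le_iSup₂_of_le h hh le_rfl
  refine le_antisymm (iSup₂_le fun h hh => ?_) ?_
  · have h1 : ENNReal.ofReal (∑ n, ((σ n : ℤ) : ℝ) * (h (x n) - h₀ (x n))) ≤
        signedExcess H h₀ σ x := le_iSup₂_of_le h hh le_rfl
    have h2 : ((∑ n, ((σ n : ℤ) : ℝ) * (h (x n) - h₀ (x n)) : ℝ) : EReal) ≤
        signedExcess H h₀ σ x := by
      refine le_trans ?_ (EReal.coe_ennreal_le_coe_ennreal_iff.2 h1)
      rw [EReal.coe_ennreal_ofReal]
      exact EReal.coe_le_coe_iff.2 (le_max_left _ _)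
    calc ((∑ n, ((σ n : ℤ) : ℝ) * h (x n) : ℝ) : EReal)
        = ((∑ n, ((σ n : ℤ) : ℝ) * (h (x n) - h₀ (x n)) : ℝ) : EReal) + (s : EReal) := by
          rw [hsum, ← EReal.coe_add, sub_add_cancel]
      _ ≤ _ := add_le_add_left h2 _
  · have h0 : (0 : EReal) ≤ S - s := by
      rw [EReal.le_sub_iff_add_le (by simp) (by simp), zero_add]
      exact hle h₀ h₀H
    have h1 : signedExcess H h₀ σ x ≤ (S - s).toENNReal := by
      refine iSup₂_le fun h hh => ?_
      rw [← EReal.coe_ennreal_le_coe_ennreal_iff, EReal.coe_toENNReal h0,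
        EReal.coe_ennreal_ofReal, hsum]
      rcases max_choice (∑ n, ((σ n : ℤ) : ℝ) * h (x n) - s) 0 with hm | hm
      · rw [hm, EReal.coe_sub]
        exact EReal.sub_le_sub (hle h hh) le_rfl
      · rw [hm]
        exact h0
    rw [← EReal.coe_ennreal_le_coe_ennreal_iff, EReal.coe_toENNReal h0] at h1
    calc _ ≤ S - s + s := add_le_add_left h1 _
      _ = S := EReal.sub_add_cancel

/-- The sign vectors `σ` and `-σ` cancel. This removes the choice of `h₀` from the Rademacher
complexity. -/
theorem sum_signedSum_eq_zero (t : Fin N → ℝ) :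
    ∑ σ : Fin N → ℤˣ, ∑ n, ((σ n : ℤ) : ℝ) * t n = 0 := by
  have h := Fintype.sum_equiv (Equiv.neg (Fin N → ℤˣ))
    (fun σ => ∑ n, ((σ n : ℤ) : ℝ) * t n) (fun σ => -∑ n, ((σ n : ℤ) : ℝ) * t n)
    (fun σ => by simp)
  rw [Finset.sum_neg_distrib] at h
  linarith

theorem sum_neg_signs {M : Type*} [AddCommMonoid M] (b : (Fin N → ℤˣ) → M) :
    ∑ σ, b (-σ) = ∑ σ, b σ :=
  Fintype.sum_equiv (Equiv.neg (Fin N → ℤˣ)) _ _ fun _ => rfl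

/-- The oscillation over `H` of the deviation of the empirical mean from the mean. -/
noncomputable def deviationOsc [MeasurableSpace Z] (H : Set (Z → ℝ)) (μ : Measure Z)
    (x : Fin N → Z) : ℝ≥0∞ :=
  ⨆ h ∈ H, ⨆ h' ∈ H,
    ENNReal.ofReal ((∑ n, (h (x n) - h' (x n))) / N - ∫ z, (h z - h' z) ∂μ)

/-- The oscillation over `H` of the difference of the empirical means over two samples. -/
noncomputable def sampleOsc (H : Set (Z → ℝ)) (p : (Fin N → Z) × (Fin N → Z)) : ℝ≥0∞ :=
  ⨆ h ∈ H, ⨆ h' ∈ H,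
    ENNReal.ofReal ((∑ n, ((h (p.1 n) - h' (p.1 n)) - (h (p.2 n) - h' (p.2 n)))) / N)

/-- The exchange of the coordinates of two samples at the indices with a negative sign. -/
def signedSwap (σ : Fin N → ℤˣ) (a : Fin N → Z × Z) : Fin N → Z × Z :=
  fun n => (if σ n = 1 then id else Prod.swap) (a n)

theorem measurePreserving_signedSwap [MeasurableSpace Z] (μ : Measure Z) [IsProbabilityMeasure μ]
    (σ : Fin N → ℤˣ) :
    MeasurePreserving (signedSwap (Z := Z) σ) (Measure.pi fun _ => μ.prod μ)
      (Measure.pi fun _ => μ.prod μ) := by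
  refine measurePreserving_pi _ _ fun n => ?_
  split_ifs
  · exact MeasurePreserving.id _
  · exact Measure.measurePreserving_swap

/-- The swap multiplies the `n`-th summand by `σ n`. The result splits into four signed sums: `h`
and `h'` on the first sample with signs `σ` and `-σ`, and on the second with `-σ` and `σ`. The
contributions of `h₀` cancel. -/
theorem sampleOsc_signedSwap_le [MeasurableSpace Z] {H : Set (Z → ℝ)} (h₀ : Z → ℝ)
    (σ : Fin N → ℤˣ) (a : Fin N → Z × Z) :
    sampleOsc H (MeasurableEquiv.arrowProdEquivProdArrow Z Z (Fin N) (signedSwap σ a)) ≤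
      ENNReal.ofReal (N : ℝ)⁻¹ *
        ((signedExcess H h₀ σ (fun n => (a n).1) + signedExcess H h₀ (-σ) fun n => (a n).1) +
          (signedExcess H h₀ σ (fun n => (a n).2) + signedExcess H h₀ (-σ) fun n => (a n).2)) := by
  refine iSup₂_le fun h hh => iSup₂_le fun h' hh' => ?_
  have hle : ∀ (τ : Fin N → ℤˣ) (g : Z → ℝ) (_ : g ∈ H) (x : Fin N → Z),
      ENNReal.ofReal (∑ n, ((τ n : ℤ) : ℝ) * (g (x n) - h₀ (x n))) ≤ signedExcess H h₀ τ x :=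
    fun τ g hg x => le_iSup₂_of_le g hg le_rfl
  refine le_trans ?_ (mul_le_mul_right (add_le_add
    (add_le_add (hle σ h hh _) (hle (-σ) h' hh' _))
    (add_le_add (hle σ h' hh' _) (hle (-σ) h hh _))) _)
  refine le_trans ?_ (mul_le_mul_right (add_le_add ENNReal.ofReal_add_le ENNReal.ofReal_add_le) _)
  refine le_trans ?_ (mul_le_mul_right ENNReal.ofReal_add_le _)
  rw [← ENNReal.ofReal_mul (by positivity), div_eq_inv_mul]
  refine le_of_eq (congrArg _ (congrArg _ ?_))
  simp only [← Finset.sum_add_distrib]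
  refine Finset.sum_congr rfl fun n _ => ?_
  change (h (signedSwap σ a n).1 - h' (signedSwap σ a n).1) -
    (h (signedSwap σ a n).2 - h' (signedSwap σ a n).2) = _
  rcases Int.units_eq_one_or (σ n) with hσ | hσ
  · simp [signedSwap, hσ]
    ring
  · simp [signedSwap, hσ]
    ring

variable [TopologicalSpace Z]

/-- A supremum of continuous functions is lower semicontinuous, which gives measurability even for
an uncountable class. -/
theorem lowerSemicontinuous_signedExcess {H : Set (Z → ℝ)} (hH : ∀ h ∈ H, Continuous h)
    {h₀ : Z → ℝ} (h₀H : h₀ ∈ H) (σ : Fin N → ℤˣ) :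
    LowerSemicontinuous (signedExcess H h₀ σ) := by
  refine lowerSemicontinuous_biSup fun h hh => Continuous.lowerSemicontinuous ?_
  have := hH h hh
  have := hH h₀ h₀H
  exact ENNReal.continuous_ofReal.comp (by fun_prop)

variable [SecondCountableTopology Z] [MeasurableSpace Z] [BorelSpace Z]

theorem measurable_signedExcess {H : Set (Z → ℝ)} (hH : ∀ h ∈ H, Continuous h)
    {h₀ : Z → ℝ} (h₀H : h₀ ∈ H) (σ : Fin N → ℤˣ) : Measurable (signedExcess H h₀ σ) :=
  (lowerSemicontinuous_signedExcess hH h₀H σ).measurable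

theorem measurable_deviationOsc {H : Set (Z → ℝ)} (hH : ∀ h ∈ H, Continuous h) (μ : Measure Z) :
    Measurable (deviationOsc (N := N) H μ) := by
  refine LowerSemicontinuous.measurable (lowerSemicontinuous_biSup fun h hh =>
    lowerSemicontinuous_biSup fun h' hh' => Continuous.lowerSemicontinuous ?_)
  have := hH h hh
  have := hH h' hh'
  exact ENNReal.continuous_ofReal.comp (by fun_prop)

theorem measurable_sampleOsc {H : Set (Z → ℝ)} (hH : ∀ h ∈ H, Continuous h) :
    Measurable (sampleOsc (N := N) H) := by
  refine LowerSemicontinuous.measurable (lowerSemicontinuous_biSup fun h hh =>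
    lowerSemicontinuous_biSup fun h' hh' => Continuous.lowerSemicontinuous ?_)
  have := hH h hh
  have := hH h' hh'
  exact ENNReal.continuous_ofReal.comp (by fun_prop)

/-- Swapping coordinates of two i.i.d. samples preserves their joint law, so the pointwise bound
after the swap may be integrated. The factor 2 counts the two samples. -/
theorem lintegral_sampleOsc_le {H : Set (Z → ℝ)} (hH : ∀ h ∈ H, Continuous h) {h₀ : Z → ℝ}
    (h₀H : h₀ ∈ H) (μ : Measure Z) [IsProbabilityMeasure μ] (σ : Fin N → ℤˣ) :
    ∫⁻ p : (Fin N → Z) × (Fin N → Z), sampleOsc H p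
        ∂(Measure.pi fun _ => μ).prod (Measure.pi fun _ => μ) ≤
      ENNReal.ofReal (N : ℝ)⁻¹ * (2 * (∫⁻ x, signedExcess H h₀ σ x ∂(Measure.pi fun _ => μ) +
        ∫⁻ x, signedExcess H h₀ (-σ) x ∂(Measure.pi fun _ => μ))) := by
  have he := measurePreserving_arrowProdEquivProdArrow Z Z (Fin N) (fun _ => μ) (fun _ => μ)
  have hK := measurable_sampleOsc (N := N) hH
  have hB := fun τ : Fin N → ℤˣ => measurable_signedExcess hH h₀H τ
  set D : (Fin N → Z) → ℝ≥0∞ := fun x => signedExcess H h₀ σ x + signedExcess H h₀ (-σ) x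
  have hD : Measurable D := (hB σ).add (hB (-σ))
  have hD1 : Measurable fun p : (Fin N → Z) × (Fin N → Z) => D p.1 := hD.comp measurable_fst
  have hD2 : Measurable fun p : (Fin N → Z) × (Fin N → Z) => D p.2 := hD.comp measurable_snd
  have hD12 : Measurable fun p : (Fin N → Z) × (Fin N → Z) => D p.1 + D p.2 := hD1.add hD2
  have hfst : MeasurePreserving (Prod.fst : (Fin N → Z) × (Fin N → Z) → _)
    ((Measure.pi fun _ => μ).prod (Measure.pi fun _ => μ)) _ := measurePreserving_fst
  have hsnd : MeasurePreserving (Prod.snd : (Fin N → Z) × (Fin N → Z) → _)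
    ((Measure.pi fun _ => μ).prod (Measure.pi fun _ => μ)) _ := measurePreserving_snd
  calc ∫⁻ p, sampleOsc H p ∂(Measure.pi fun _ => μ).prod (Measure.pi fun _ => μ)
      = ∫⁻ a, sampleOsc H (MeasurableEquiv.arrowProdEquivProdArrow Z Z (Fin N) a)
          ∂Measure.pi fun _ => μ.prod μ := (he.lintegral_comp hK).symm
    _ = ∫⁻ a, sampleOsc H (MeasurableEquiv.arrowProdEquivProdArrow Z Z (Fin N) (signedSwap σ a))
          ∂Measure.pi fun _ => μ.prod μ :=
        ((measurePreserving_signedSwap μ σ).lintegral_comp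
          (hK.comp (MeasurableEquiv.measurable _))).symm
    _ ≤ ∫⁻ a, ENNReal.ofReal (N : ℝ)⁻¹ * (D (fun n => (a n).1) + D (fun n => (a n).2))
          ∂Measure.pi fun _ => μ.prod μ := lintegral_mono fun a => sampleOsc_signedSwap_le h₀ σ a
    _ = ∫⁻ p : (Fin N → Z) × (Fin N → Z), ENNReal.ofReal (N : ℝ)⁻¹ * (D p.1 + D p.2)
          ∂(Measure.pi fun _ => μ).prod (Measure.pi fun _ => μ) :=
        he.lintegral_comp (hD12.const_mul _)
    _ = _ := by
        rw [lintegral_const_mul _ hD12, lintegral_add_left hD1, hfst.lintegral_comp hD,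
          hsnd.lintegral_comp hD, ← two_mul, lintegral_add_left (hB σ)]

variable [CompactSpace Z]

/-- The Rademacher complexity of a class of continuous functions is nonnegative. -/
theorem rademacherComplexity_eq {H : Set (Z → ℝ)} (hH : ∀ h ∈ H, Continuous h) {h₀ : Z → ℝ}
    (h₀H : h₀ ∈ H) (μ : Measure Z) [IsProbabilityMeasure μ] :
    rademacherComplexity N H μ =
      ((ENNReal.ofReal ((N : ℝ) * 2 ^ N)⁻¹ * ∑ σ : Fin N → ℤˣ,
        ∫⁻ x, signedExcess H h₀ σ x ∂Measure.pi fun _ => μ : ℝ≥0∞) : EReal) := by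
  have hc := hH h₀ h₀H
  have hint : ∀ σ : Fin N → ℤˣ, Integrable
      (fun x : Fin N → Z => ∑ n, ((σ n : ℤ) : ℝ) * h₀ (x n)) (Measure.pi fun _ => μ) := fun σ =>
    Continuous.integrable_of_compactSpace (by fun_prop) _
  rw [rademacherComplexity, EReal.coe_ennreal_mul, EReal.coe_ennreal_ofReal,
    max_eq_left (by positivity), EReal.coe_ennreal_sum]
  congr 1
  simp only [iSup_signedSum_eq h₀H]
  rw [Finset.sum_congr rfl fun σ _ => extIntegral_coe_add
    (measurable_signedExcess hH h₀H σ).aemeasurable (hint σ), Finset.sum_add_distrib,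
    ← EReal.coe_real_sum, ← integral_finsetSum _ fun σ _ => hint σ]
  -- The real terms left by `h₀` sum to zero over the signs.
  simp [sum_signedSum_eq_zero]

/-- The mean is the expectation of the empirical mean over a ghost sample `x'`; the supremum of an
expectation is at most the expectation of the supremum. -/
theorem deviationOsc_le_lintegral {H : Set (Z → ℝ)} (hH : ∀ h ∈ H, Continuous h) (μ : Measure Z)
    [IsProbabilityMeasure μ] (hN : 0 < N) (x : Fin N → Z) :
    deviationOsc H μ x ≤ ∫⁻ x', sampleOsc H (x, x') ∂Measure.pi fun _ => μ := by
  refine iSup₂_le fun h hh => iSup₂_le fun h' hh' => ?_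
  have hc := hH h hh
  have hc' := hH h' hh'
  have hint : Integrable (fun x' : Fin N → Z =>
      (∑ n, ((h (x n) - h' (x n)) - (h (x' n) - h' (x' n)))) / N) (Measure.pi fun _ => μ) :=
    Continuous.integrable_of_compactSpace (by fun_prop) _
  have hN' : (N : ℝ) ≠ 0 := by positivity
  have heq : ∫ x' : Fin N → Z, (∑ n, ((h (x n) - h' (x n)) - (h (x' n) - h' (x' n)))) / N
      ∂Measure.pi (fun _ => μ) = (∑ n, (h (x n) - h' (x n))) / N - ∫ z, (h z - h' z) ∂μ := by
    have hn : ∀ n : Fin N, ∫ x' : Fin N → Z, (h (x n) - h' (x n)) - (h (x' n) - h' (x' n))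
        ∂Measure.pi (fun _ => μ) = (h (x n) - h' (x n)) - ∫ z, (h z - h' z) ∂μ := fun n => by
      rw [integral_sub (integrable_const _)
        (Continuous.integrable_of_compactSpace (by fun_prop) _), integral_const,
        integral_comp_eval (μ := fun _ : Fin N => μ) (i := n) (f := fun z => h z - h' z)
          (hc.sub hc').aestronglyMeasurable]
      simp
    rw [integral_div, integral_finsetSum _ fun n _ =>
      Continuous.integrable_of_compactSpace (by fun_prop) _, Finset.sum_congr rfl fun n _ => hn n,
      Finset.sum_sub_distrib]
    simp
    field_simp
  rw [← heq]
  refine (ofReal_integral_le_lintegral hint).trans (lintegral_mono fun x' => ?_)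
  exact le_iSup₂_of_le h hh (le_iSup₂_of_le h' hh' le_rfl)

/-- Symmetrization: the expected oscillation of the deviation of the empirical mean is at most
four times the Rademacher complexity. -/
theorem lintegral_deviationOsc_le {H : Set (Z → ℝ)} (hH : ∀ h ∈ H, Continuous h)
    (hne : H.Nonempty) (μ : Measure Z) [IsProbabilityMeasure μ] (hN : 0 < N) :
    ((∫⁻ x : Fin N → Z, deviationOsc H μ x ∂(Measure.pi fun _ => μ) : ℝ≥0∞) : EReal) ≤
      4 * rademacherComplexity N H μ := by
  obtain ⟨h₀, h₀H⟩ := hne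
  rw [rademacherComplexity_eq hH h₀H μ]
  set b : (Fin N → ℤˣ) → ℝ≥0∞ := fun σ => ∫⁻ x, signedExcess H h₀ σ x ∂Measure.pi fun _ => μ
  set G := ∫⁻ x : Fin N → Z, deviationOsc H μ x ∂(Measure.pi fun _ => μ)
  have hG : ∀ σ, G ≤ ENNReal.ofReal (N : ℝ)⁻¹ * (2 * (b σ + b (-σ))) := fun σ => by
    refine le_trans ?_ (lintegral_sampleOsc_le hH h₀H μ σ)
    rw [lintegral_prod _ (measurable_sampleOsc hH).aemeasurable]
    exact lintegral_mono fun x => deviationOsc_le_lintegral hH μ hN x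
  -- Sum over all sign vectors: `σ` and `-σ` contribute equally, doubling the existing factor 2.
  have hsum : 2 ^ N * G ≤ ENNReal.ofReal (N : ℝ)⁻¹ * (4 * ∑ σ, b σ) := by
    have := Finset.sum_le_sum fun σ (_ : σ ∈ (Finset.univ : Finset (Fin N → ℤˣ))) => hG σ
    rw [← Finset.mul_sum, ← Finset.mul_sum, Finset.sum_add_distrib, sum_neg_signs, ← two_mul,
      ← mul_assoc 2 2] at this
    simpa [show (2 : ℝ≥0∞) * 2 = 4 by norm_num] using this
  have : G ≤ 4 * (ENNReal.ofReal ((N : ℝ) * 2 ^ N)⁻¹ * ∑ σ, b σ) := by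
    calc G = (2 ^ N)⁻¹ * (2 ^ N * G) := by
          rw [← mul_assoc, ENNReal.inv_mul_cancel (by simp) (by simp), one_mul]
      _ ≤ (2 ^ N)⁻¹ * (ENNReal.ofReal (N : ℝ)⁻¹ * (4 * ∑ σ, b σ)) := mul_le_mul_right hsum _
      _ = 4 * (ENNReal.ofReal ((N : ℝ) * 2 ^ N)⁻¹ * ∑ σ, b σ) := by
          rw [mul_inv, ENNReal.ofReal_mul (by positivity),
            ENNReal.ofReal_inv_of_pos (by positivity : (0 : ℝ) < 2 ^ N),
            ENNReal.ofReal_pow (by norm_num), ENNReal.ofReal_ofNat]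
          ring
  have := EReal.coe_ennreal_le_coe_ennreal_iff.2 this
  rwa [EReal.coe_ennreal_mul] at this

end Rademacher

/-! ### Empirical maximizers and the final bound -/

namespace EOT

theorem IsOptimalPlan.primalObjective_eq {X Y : Type*} [MeasurableSpace X]
    [TopologicalSpace Y] [MeasureSpace Y] [StandardBorelSpace Y] [Nonempty Y] {c : X → Y → ℝ}
    {ε : ℝ} {P : Measure X} {Q : Measure Y} {π : ProbabilityMeasure (X × Y)} (hπ : IsOptimalPlan c ε P Q π) :
    primalObjective c ε P π = optimalValue c ε P Q :=
  le_antisymm (le_iInf₂ hπ.2) (iInf₂_le _ hπ.1)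

section

variable {X Y : Type*} [TopologicalSpace X] [T2Space X] [CompactSpace X]
  [SecondCountableTopology X] [MeasurableSpace X] [BorelSpace X] [TopologicalSpace Y]
  [CompactSpace Y] [SecondCountableTopology Y] [MeasureSpace Y] [BorelSpace Y]
  [IsFiniteMeasure (volume : Measure Y)] [NeZero (volume : Measure Y)] {c : X → Y → ℝ} {ε : ℝ}

/-- The suboptimality of a maximizer of the empirical dual objective is bounded by the
deviations of the empirical means. -/
theorem ofReal_sSup_sub_weakDual_le (hε : 0 < ε) (hc : Continuous fun p : X × Y => c p.1 p.2)
    (P : Measure X) [IsProbabilityMeasure P] (Q : Measure Y) [IsProbabilityMeasure Q]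
    {F : Set C(Y, ℝ)} {N M : ℕ} (x : Fin N → X) (y : Fin M → Y) {g : C(Y, ℝ)} (hg : g ∈ F)
    (hmax : IsMaxOn (empiricalDual c ε x y) F g) :
    ENNReal.ofReal (sSup (weakDual c ε P Q '' F) - weakDual c ε P Q g) ≤
      deviationOsc (transformClass c ε F) P x +
        deviationOsc ((fun f : C(Y, ℝ) => (f : Y → ℝ)) '' F) Q y := by
  set T : C(Y, ℝ) → X → ℝ := fun f x => -ε * Real.log (partition c ε f x)
  set A := deviationOsc (transformClass c ε F) P x
  set B := deviationOsc ((fun f : C(Y, ℝ) => (f : Y → ℝ)) '' F) Q y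
  have hT : ∀ f, Integrable (T f) P := fun f =>
    ((continuous_log_partition hc f).const_mul (-ε)).integrable_of_compactSpace P
  have hI : ∀ f : C(Y, ℝ), Integrable f Q := fun f => f.continuous.integrable_of_compactSpace Q
  have hone : ∀ f ∈ F, ENNReal.ofReal (weakDual c ε P Q f - weakDual c ε P Q g) ≤ A + B := by
    intro f hf
    have hA : ENNReal.ofReal ((∑ n, (T g (x n) - T f (x n))) / N - ∫ z, (T g z - T f z) ∂P) ≤ A :=
      le_iSup₂_of_le (T g) ⟨g, hg, rfl⟩ (le_iSup₂_of_le (T f) ⟨f, hf, rfl⟩ le_rfl)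
    have hB : ENNReal.ofReal ((∑ m, (g (y m) - f (y m))) / M - ∫ z, (g z - f z) ∂Q) ≤ B :=
      le_iSup₂_of_le (g : Y → ℝ) ⟨g, hg, rfl⟩ (le_iSup₂_of_le (f : Y → ℝ) ⟨f, hf, rfl⟩ le_rfl)
    refine (ENNReal.ofReal_le_ofReal ?_).trans
      (ENNReal.ofReal_add_le.trans (add_le_add hA hB))
    -- In `F^w(f) - F^w(g)`, the two empirical values can be inserted because their difference has
    -- the favourable sign; what remains is the deviation for the pair `(g, f)` in each sample.
    have hm : empiricalDual c ε x y f ≤ empiricalDual c ε x y g := hmax hf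
    have hemp : ∀ f, empiricalDual c ε x y f = (∑ n, T f (x n)) / N + (∑ m, f (y m)) / M := by
      intro f
      simp only [empiricalDual, T, ← Finset.mul_sum]
      ring
    rw [hemp, hemp] at hm
    rw [integral_sub (hT g) (hT f), integral_sub (hI g) (hI f), weakDual_eq hε hc,
      weakDual_eq hε hc, Finset.sum_sub_distrib, Finset.sum_sub_distrib, sub_div, sub_div]
    linarith
  by_cases htop : A + B = ∞
  · rw [htop]
    exact le_top
  · refine ENNReal.ofReal_le_of_le_toReal ?_
    rw [sub_le_iff_le_add]
    refine csSup_le ⟨_, g, hg, rfl⟩ ?_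
    rintro _ ⟨f, hf, rfl⟩
    have := (ENNReal.ofReal_le_iff_le_toReal htop).1 (hone f hf)
    linarith

end

end EOT

theorem EReal.exists_coe_of_mul_add_ne_top {ε : ℝ} (hε : 0 < ε) {k : ℝ≥0∞} {w : ℝ} {v : EReal}
    (hv : v = (ε : EReal) * k + (w : EReal)) (hne : v ≠ ⊤) :
    v = ((ε * k.toReal + w : ℝ) : EReal) ∧ k ≠ ∞ := by
  induction k with
  | top =>
    rw [EReal.coe_ennreal_top, EReal.coe_mul_top_of_pos hε, EReal.top_add_coe] at hv
    exact absurd hv hne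
  | coe k =>
    refine ⟨?_, ENNReal.coe_ne_top⟩
    rw [hv]
    rfl

theorem theorem4 {dX dY : ℕ}
    (X : NonemptyCompacts (EuclideanSpace ℝ (Fin dX)))
    (Y : NonemptyCompacts (EuclideanSpace ℝ (Fin dY)))
    (hY : 0 < volume (Y : Set (EuclideanSpace ℝ (Fin dY))))
    (c : X → Y → ℝ) (hc : Continuous fun p : X × Y => c p.1 p.2)
    (ε : ℝ) (hε : 0 < ε)
    (P : Measure X) [IsProbabilityMeasure P] (Q : Measure Y) [IsProbabilityMeasure Q]
    (πopt : ProbabilityMeasure (X × Y)) (hπopt : EOT.IsOptimalPlan c ε P Q πopt)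
    (F : Set C(Y, ℝ)) (hF : BddAbove (EOT.weakDual c ε P Q '' F))
    (N M : ℕ) (hN : 0 < N) (hM : 0 < M)
    {Ω : Type*} [MeasurableSpace Ω] (Pr : Measure Ω) [IsProbabilityMeasure Pr]
    (x : Fin N → Ω → X) (hx : ∀ n, HasLaw (x n) P Pr) (hx_indep : iIndepFun x Pr)
    (y : Fin M → Ω → Y) (hy : ∀ m, HasLaw (y m) Q Pr) (hy_indep : iIndepFun y Pr)
    (fhat : Ω → C(Y, ℝ))
    (hfhat : ∀ᵐ ω ∂Pr, fhat ω ∈ F ∧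
      IsMaxOn (EOT.empiricalDual c ε (fun n => x n ω) (fun m => y m ω)) F (fhat ω)) :
    ((∫⁻ ω, InformationTheory.klDiv (πopt : Measure (X × Y)) (EOT.plan c ε P (fhat ω)) ∂Pr :
        ℝ≥0∞) : EReal) ≤
      ((ε⁻¹ : ℝ) : EReal) *
          (4 * rademacherComplexity N (EOT.transformClass c ε F) P +
            4 * rademacherComplexity M ((fun f : C(Y, ℝ) => (f : Y → ℝ)) '' F) Q) +
        ((ε⁻¹ : ℝ) : EReal) *
          (EOT.optimalValue c ε P Q - ((sSup (EOT.weakDual c ε P Q '' F) : ℝ) : EReal)) := by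
  have : CompactSpace X := isCompact_iff_compactSpace.mp X.isCompact
  have : CompactSpace Y := isCompact_iff_compactSpace.mp Y.isCompact
  have : NeZero (volume : Measure Y) := ⟨fun h => hY.ne' (by rw [← EOT.volume_univ, h]; rfl)⟩
  -- An almost sure event is nonempty, so `F` is nonempty; this supplies the base points for
  -- symmetrization.
  obtain ⟨ω₀, hω₀, -⟩ := hfhat.exists
  set HX := EOT.transformClass c ε F
  set HY := (fun f : C(Y, ℝ) => (f : Y → ℝ)) '' F
  set s := sSup (EOT.weakDual c ε P Q '' F)
  set KL : C(Y, ℝ) → ℝ≥0∞ := fun f =>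
    InformationTheory.klDiv (πopt : Measure (X × Y)) (EOT.plan c ε P f)
  have hHX : ∀ h ∈ HX, Continuous h := EOT.continuous_of_mem_transformClass hc
  have hHY : ∀ h ∈ HY, Continuous h := by
    rintro _ ⟨f, -, rfl⟩
    exact f.continuous
  have hRX := lintegral_deviationOsc_le hHX ⟨_, fhat ω₀, hω₀, rfl⟩ P hN
  have hRY := lintegral_deviationOsc_le hHY ⟨_, fhat ω₀, hω₀, rfl⟩ Q hM
  have hε' : (0 : EReal) ≤ ((ε⁻¹ : ℝ) : EReal) := by exact_mod_cast (inv_pos.2 hε).le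
  have hgap : ∀ f, EOT.optimalValue c ε P Q = (ε : EReal) * KL f +
      (EOT.weakDual c ε P Q f : EReal) := fun f => by
    rw [← hπopt.primalObjective_eq, EOT.primalObjective_eq hε hc hπopt.1]
  -- With infinite optimal value the right side is `⊤`, because the complexity term is nonnegative
  -- and so cannot be `⊥`.
  by_cases htop : EOT.optimalValue c ε P Q = ⊤
  · have hR : (0 : EReal) ≤ ((ε⁻¹ : ℝ) : EReal) *
        (4 * rademacherComplexity N HX P + 4 * rademacherComplexity M HY Q) :=
      mul_nonneg hε' (add_nonneg ((EReal.coe_ennreal_nonneg _).trans hRX)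
        ((EReal.coe_ennreal_nonneg _).trans hRY))
    rw [htop, EReal.top_sub_coe, EReal.coe_mul_top_of_pos (inv_pos.2 hε),
      EReal.add_top_of_ne_bot (ne_bot_of_le_ne_bot EReal.zero_ne_bot hR)]
    exact le_top
  · have hval := fun f => (EReal.exists_coe_of_mul_add_ne_top hε (hgap f) htop)
    set r := ε * (KL (fhat ω₀)).toReal + EOT.weakDual c ε P Q (fhat ω₀)
    have hr : EOT.optimalValue c ε P Q = (r : EReal) := (hval (fhat ω₀)).1
    have hfin : ∀ f, ε * (KL f).toReal + EOT.weakDual c ε P Q f = r := fun f => by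
      have := (hval f).1
      rw [hr] at this
      exact_mod_cast this.symm
    -- Weak duality, read off from the exact gap; it makes the approximation term nonnegative.
    have hsr : s ≤ r := by
      refine csSup_le ⟨_, _, hω₀, rfl⟩ ?_
      rintro _ ⟨f, -, rfl⟩
      have := hfin f
      have : 0 ≤ ε * (KL f).toReal := by positivity
      linarith
    -- The random `f̂` is eliminated pointwise, before integration: the bound depends on `ω` only
    -- through measurable functions of the samples, so no measurability of `f̂` is needed.
    have hpt : ∀ᵐ ω ∂Pr, KL (fhat ω) ≤ ENNReal.ofReal (ε⁻¹ * (r - s)) + ENNReal.ofReal ε⁻¹ *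
        (deviationOsc HX P (fun n => x n ω) + deviationOsc HY Q fun m => y m ω) := by
      filter_upwards [hfhat] with ω hω
      have h1 := EOT.ofReal_sSup_sub_weakDual_le hε hc P Q _ _ hω.1 hω.2
      have h2 : KL (fhat ω) = ENNReal.ofReal (ε⁻¹ * (r - s) +
          ε⁻¹ * (s - EOT.weakDual c ε P Q (fhat ω))) := by
        rw [← ENNReal.ofReal_toReal (hval (fhat ω)).2, ← hfin (fhat ω)]
        congr 1
        field_simp
        ring
      rw [h2]
      refine ENNReal.ofReal_add_le.trans (add_le_add le_rfl ?_)
      rw [ENNReal.ofReal_mul (inv_pos.2 hε).le]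
      exact mul_le_mul_right h1 _
    have hlawX := hx_indep.hasLaw_pi hx
    have hlawY := hy_indep.hasLaw_pi hy
    have hmX := measurable_deviationOsc (N := N) hHX P
    have hmY := measurable_deviationOsc (N := M) hHY Q
    have hint : ∫⁻ ω, KL (fhat ω) ∂Pr ≤ ENNReal.ofReal (ε⁻¹ * (r - s)) + ENNReal.ofReal ε⁻¹ *
        (∫⁻ z : Fin N → X, deviationOsc HX P z ∂(Measure.pi fun _ => P) +
          ∫⁻ z : Fin M → Y, deviationOsc HY Q z ∂(Measure.pi fun _ => Q)) := by
      refine (lintegral_mono_ae hpt).trans_eq ?_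
      rw [lintegral_add_left measurable_const, lintegral_const_mul' _ _ ENNReal.ofReal_ne_top,
        lintegral_add_left' (f := fun ω => deviationOsc HX P fun n => x n ω)
          (hmX.comp_aemeasurable hlawX.aemeasurable),
        hlawX.lintegral_comp hmX.aemeasurable, hlawY.lintegral_comp hmY.aemeasurable]
      simp
    refine (EReal.coe_ennreal_le_coe_ennreal_iff.2 hint).trans ?_
    rw [EReal.coe_ennreal_add, EReal.coe_ennreal_mul, EReal.coe_ennreal_add,
      EReal.coe_ennreal_ofReal, EReal.coe_ennreal_ofReal, max_eq_left (inv_pos.2 hε).le,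
      max_eq_left (mul_nonneg (inv_pos.2 hε).le (sub_nonneg.2 hsr)), add_comm, hr,
      EReal.coe_mul, EReal.coe_sub]
    exact add_le_add (mul_le_mul_of_nonneg_left (add_le_add hRX hRY) hε') le_rfl
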